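/- All systems are finite-dimensional complex Hilbert spaces with a fixed computational basis, $\Delta$ is the completely dephasing map in that basis, states are positive semidefinite operators of unit trace, quantum operations are completely positive trace-preserving linear maps, and $|A|$ is the dimension of $A$. For positive semidefinite $\rho,\sigma$ the purified distance is $P(\rho,\sigma)=\sqrt{1-F(\rho,\sigma)^2}$ with $F(\rho,\sigma)=\|\sqrt\rho\sqrt\sigma\|_1+\sqrt{(1-\operatorname{tr}\rho)(1-\operatorname{tr}\sigma)}$; $\Psi_{B}$ is the maximally coherent state $|\Psi_B\rangle=|B|^{-1/2}\sum_b|b\rangle$, and $\pi_L$ is the completely mixed state. Let $\mathcal{QI}(A{:}B)$ be the set of states $\sum_b p_b\,\sigma_A^b\otimes|b\rangle\langle b|_B$ with $(p_b)$ a probability distribution and $\sigma^b_A$ states, and let $\mathrm{QIP}$ be the class of quantum operations $\Lambda_{AB\to A'B'}$ ($A',B'$ of any finite dimensions) that map $\mathcal{QI}(A{:}B)$ into $\mathcal{QI}(A'{:}B')$. For a class $\mathcal F$ of bipartite quantum operations, a bipartite state $\rho_{AB}$ and $\varepsilon\in[0,1]$, let the one-shot assisted distillable coherence be $$C^{\varepsilon}_{d,\mathcal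 F}(\rho_{AB})=\max\{\log_2|B'| : P(\operatorname{tr}_{A'}\Lambda_{AB\to A'B'}(\rho_{AB}),\Psi_{B'})\le\varepsilon,\ \Lambda\in\mathcal F\}.$$ Let $|\psi\rangle_{RAB}$ be a purification of $\rho_{AB}$. For $\Lambda_{AB\to A'B'}\in\mathcal F$ with a Stinespring isometry $U_{AB\to A'B'E}$, and a function $f$ from the basis labels of $B'$ to those of a system $L$, let $\rho[\Lambda,\Delta,f]_{LER}$ be the state obtained from $U|\psi\rangle\langle\psi|U^\dagger$ by dephasing $B'$, applying $f$ to the resulting classical register $B'$, and discarding $A'$. With $d_{sec}(\tau_{LER}|ER)=\min_{\sigma_{ER}}P(\tau_{LER},\pi_L\otimes\sigma_{ER})$, the minimum being over states $\sigma_{ER}$, let the one-shot assisted extractable randomness be $$\ell^{\varepsilon}_{\mathcal F}(\rho_{AB})=\max\{\log_2|L| : d_{sec}(\rho[\Lambda,\Delta,f]_{LER}|ER)\le\varepsilon,\ \Lambda\in\mathcal F\}.$$ (Each maximum is read as a supremum in $[-\infty,+\infty]$.) Theorem. For every bipartite state $\rho_{AB}$, every purification $|\psi\rangle_{RAB}$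 of it and every $\varepsilon\in[0,1]$, $$C^{\varepsilon}_{d,\mathrm{QIP}}(\rho_{AB})=\ell^{\varepsilon}_{\mathrm{QIP}}(\rho_{AB}),$$ and for $\varepsilon<1$ both maxima are attained. Moreover, $C^{\varepsilon}_{d,\mathcal F}(\rho_{AB})\le\ell^{\varepsilon}_{\mathcal F}(\rho_{AB})$ for every class $\mathcal F$ of bipartite quantum operations. -/

import Mathlib

open scoped ComplexOrder MatrixOrder Kronecker

noncomputable section

namespace AssistedCoherence

/-! Systems are finite-dimensional complex Hilbert spaces with a fixed computational basis; an
operator on a system with basis labels `m` is a `Matrix m m ℂ`, and composite systems are labelled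
by products. -/

section States

variable {m n k : Type*} [Fintype m] [DecidableEq m] [Fintype n] [DecidableEq n]
  [Fintype k] [DecidableEq k]

/-- Quantum states: positive semidefinite operators of unit trace. -/
def IsState (ρ : Matrix m m ℂ) : Prop := ρ.PosSemidef ∧ ρ.trace = 1

/-- The trace norm `‖X‖₁ = tr √(X† X)`. -/
def traceNorm (X : Matrix m m ℂ) : ℝ := (CFC.sqrt (X.conjTranspose * X)).trace.re

/-- The generalized fidelity `F(ρ,σ) = ‖√ρ √σ‖₁ + √((1 - tr ρ)(1 - tr σ))`. -/
def fidelity (ρ σ : Matrix m m ℂ) : ℝ :=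
  traceNorm (CFC.sqrt ρ * CFC.sqrt σ) + √((1 - ρ.trace.re) * (1 - σ.trace.re))

/-- The purified distance `P(ρ,σ) = √(1 - F(ρ,σ)²)`. -/
def purifiedDistance (ρ σ : Matrix m m ℂ) : ℝ := √(1 - fidelity ρ σ ^ 2)

/-- Partial trace over the first tensor factor. -/
def traceFst (M : Matrix (m × n) (m × n) ℂ) : Matrix n n ℂ :=
  Matrix.of fun i j => ∑ a, M (a, i) (a, j)

/-- Partial trace over the second tensor factor. -/
def traceSnd (M : Matrix (m × n) (m × n) ℂ) : Matrix m m ℂ :=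
  Matrix.of fun i j => ∑ a, M (i, a) (j, a)

/-- The rank-one operator `|v⟩⟨v|`. -/
def ketbra (v : m → ℂ) : Matrix m m ℂ := Matrix.vecMulVec v (star v)

/-- The completely mixed state `π = 1 / dim`. -/
def maximallyMixed (m : Type*) [Fintype m] [DecidableEq m] : Matrix m m ℂ :=
  ((Fintype.card m : ℂ)⁻¹) • (1 : Matrix m m ℂ)

/-- The maximally coherent state vector, all of whose amplitudes are `1 / √dim`. -/
def mcsVector (m : Type*) [Fintype m] : m → ℂ := fun _ => ((1 / √(Fintype.card m : ℝ) : ℝ) : ℂ)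

/-- The density operator `Ψ` of the maximally coherent state. -/
def mcs (m : Type*) [Fintype m] : Matrix m m ℂ := ketbra (mcsVector m)

/-- The map `Φ ⊗ id_k`. -/
def ampliation (Φ : Matrix m m ℂ →ₗ[ℂ] Matrix n n ℂ) (k : Type*)
    (M : Matrix (m × k) (m × k) ℂ) : Matrix (n × k) (n × k) ℂ :=
  Matrix.of fun x y => Φ (Matrix.of fun i j => M (i, x.2) (j, y.2)) x.1 y.1

/-- Complete positivity: `Φ ⊗ id` preserves positive semidefiniteness for every finite ancilla. -/
def IsCompletelyPositive (Φ : Matrix m m ℂ →ₗ[ℂ] Matrix n n ℂ) : Prop :=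
  ∀ (d : ℕ) (M : Matrix (m × Fin d) (m × Fin d) ℂ),
    M.PosSemidef → (ampliation Φ (Fin d) M).PosSemidef

/-- Quantum operations: completely positive trace-preserving linear maps. -/
def IsChannel (Φ : Matrix m m ℂ →ₗ[ℂ] Matrix n n ℂ) : Prop :=
  IsCompletelyPositive Φ ∧ ∀ X, (Φ X).trace = X.trace

/-- `ψ` is a purification of `ρ`, with reference system `k`. -/
def IsPurification (ψ : m × k → ℂ) (ρ : Matrix m m ℂ) : Prop := traceSnd (ketbra ψ) = ρ

/-- `U`, from `m` to `n ⊗ k`, is a Stinespring isometry of `Φ` with environment `k`. -/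
def IsStinespring (U : Matrix (n × k) m ℂ) (Φ : Matrix m m ℂ →ₗ[ℂ] Matrix n n ℂ) : Prop :=
  U.conjTranspose * U = 1 ∧ ∀ X, Φ X = traceSnd (U * X * U.conjTranspose)

/-- The security measure `d_sec(ρ_{LR}|R) = min_{σ_R} P(ρ_{LR}, π_L ⊗ σ_R)` over states `σ_R`. -/
def dsec (ρ : Matrix (m × k) (m × k) ℂ) : ℝ :=
  ⨅ σ : {σ : Matrix k k ℂ // IsState σ}, purifiedDistance ρ (maximallyMixed m ⊗ₖ σ.1)

end States

section Bipartite

variable {A B A' B' L E R : Type*} [Fintype A] [DecidableEq A] [Fintype B] [DecidableEq B]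
  [Fintype A'] [DecidableEq A'] [Fintype B'] [DecidableEq B'] [Fintype L] [DecidableEq L]
  [Fintype E] [DecidableEq E] [Fintype R] [DecidableEq R]

/-- Quantum-incoherent states `∑_b p_b σ^b_A ⊗ |b⟩⟨b|_B`. -/
def QI (A B : Type*) [Fintype A] [DecidableEq A] [Fintype B] [DecidableEq B] :
    Set (Matrix (A × B) (A × B) ℂ) :=
  {σ | ∃ (p : B → ℝ) (τ : B → Matrix A A ℂ), (∀ b, 0 ≤ p b) ∧ ∑ b, p b = 1 ∧
    (∀ b, IsState (τ b)) ∧ σ = ∑ b, (p b : ℂ) • (τ b ⊗ₖ Matrix.single b b (1 : ℂ))}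

/-- The linear maps from operators on `AB` to operators on `A'B'`. -/
abbrev BipartiteMap (A B A' B' : Type*) : Type _ :=
  Matrix (A × B) (A × B) ℂ →ₗ[ℂ] Matrix (A' × B') (A' × B') ℂ

/-- Quantum-incoherent-state-preserving operations: the quantum operations that map
quantum-incoherent states to quantum-incoherent states. -/
def IsQIP (Λ : BipartiteMap A B A' B') : Prop :=
  IsChannel Λ ∧ ∀ σ ∈ QI A B, Λ σ ∈ QI A' B'

/-- The vector `(U_{AB → A'B'E} ⊗ 1_R) |ψ⟩_{ABR}`, on `A'B'` and Eve's system `ER`. -/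
def outputVector (U : Matrix ((A' × B') × E) (A × B) ℂ) (ψ : (A × B) × R → ℂ) :
    A' × (B' × (E × R)) → ℂ :=
  fun x => ∑ ab, U ((x.1, x.2.1), x.2.2.1) ab * ψ (ab, x.2.2.2)

/-- The completely dephasing channel `Δ_B`, applied to the middle factor of `ABE`. -/
def dephase (M : Matrix (A × (B × E)) (A × (B × E)) ℂ) :
    Matrix (A × (B × E)) (A × (B × E)) ℂ :=
  Matrix.of fun x y => if x.2.1 = y.2.1 then M x y else 0

/-- Application of `f` to the classical middle factor:
`∑_b |b⟩⟨b| ⊗ M_b` is sent to `∑_b |f b⟩⟨f b| ⊗ M_b`. -/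
def applyHash (f : B → L) (M : Matrix (A × (B × E)) (A × (B × E)) ℂ) :
    Matrix (A × (L × E)) (A × (L × E)) ℂ :=
  Matrix.of fun x y =>
    ∑ b, if f b = x.2.1 ∧ f b = y.2.1 then M (x.1, (b, x.2.2)) (y.1, (b, y.2.2)) else 0

/-- The state `ρ[Λ,Δ,f]_{LER}` left, after discarding `A'`, by the protocol `(Λ,Δ,f)` run on the
purification `ψ`, where `U` is a Stinespring isometry of `Λ`. -/
def extractionOutput (U : Matrix ((A' × B') × E) (A × B) ℂ) (f : B' → L)
    (ψ : (A × B) × R → ℂ) : Matrix (L × (E × R)) (L × (E × R)) ℂ :=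
  traceFst (applyHash f (dephase (ketbra (outputVector U ψ))))

end Bipartite

/-- A class of bipartite maps, between systems of all finite dimensions. -/
abbrev BipartiteClass : Type :=
  ∀ a b a' b' : ℕ, Set (BipartiteMap (Fin a) (Fin b) (Fin a') (Fin b'))

/-- The class of quantum-incoherent-state-preserving operations. -/
def QIP : BipartiteClass := fun _ _ _ _ => {Λ | IsQIP Λ}

variable {a b r : ℕ}

/-- The values `log₂ |B'|` that assisted coherence distillation by operations in `F` can reach from
`ρ` with error at most `ε`. -/
def distillationRates (F : BipartiteClass) (ε : ℝ)
    (ρ : Matrix (Fin a × Fin b) (Fin a × Fin b) ℂ) : Set EReal :=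
  {x | ∃ (a' b' : ℕ) (Λ : BipartiteMap (Fin a) (Fin b) (Fin a') (Fin b')),
    Λ ∈ F a b a' b' ∧ purifiedDistance (traceFst (Λ ρ)) (mcs (Fin b')) ≤ ε ∧
    x = (Real.logb 2 b' : ℝ)}

/-- The one-shot assisted distillable coherence. -/
def distillableCoherence (F : BipartiteClass) (ε : ℝ)
    (ρ : Matrix (Fin a × Fin b) (Fin a × Fin b) ℂ) : EReal :=
  sSup (distillationRates F ε ρ)

/-- The values `log₂ |L|` that assisted randomness extraction protocols `(Λ,Δ,f)` with `Λ` in `F`,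
with a Stinespring isometry `U` of `Λ` whose environment `E` goes to Eve, can reach from the
purification `ψ` with security parameter at most `ε`. -/
def extractionRates (F : BipartiteClass) (ε : ℝ)
    (ψ : (Fin a × Fin b) × Fin r → ℂ) : Set EReal :=
  {x | ∃ (a' b' : ℕ) (Λ : BipartiteMap (Fin a) (Fin b) (Fin a') (Fin b')), Λ ∈ F a b a' b' ∧
    ∃ (e : ℕ) (U : Matrix ((Fin a' × Fin b') × Fin e) (Fin a × Fin b) ℂ), IsStinespring U Λ ∧
    ∃ (l : ℕ) (f : Fin b' → Fin l), dsec (extractionOutput U f ψ) ≤ ε ∧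
    x = (Real.logb 2 l : ℝ)}

/-- The one-shot assisted extractable randomness. -/
def extractableRandomness (F : BipartiteClass) (ε : ℝ)
    (ψ : (Fin a × Fin b) × Fin r → ℂ) : EReal :=
  sSup (extractionRates F ε ψ)

end AssistedCoherence

end

/-!
For quantum-incoherent-state-preserving operations the two sets of achievable rates are equal, value
by value, and one inclusion holds for every class of quantum operations. Throughout, a Stinespring
isometry of the operation turns `ψ` into a vector `φ` on `A' B' V`, with `V = E R` held by Eve.

*Coherence gives randomness* (`dsec_hashMatrix_id_le`). Take `f = id`. Projecting `φ` onto the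
maximally coherent state of `B'` leaves a vector on `A' V`; let `σ` be its normalised marginal on
Eve's system. Copying the basis labels of `B'` turns the maximally coherent vector times this one
into a purification of `π ⊗ σ`, and `φ` into one of the extracted state. Their overlap is the
fidelity of the distilled state with `Ψ`, and by the easy half of Uhlmann's theorem
(`norm_trace_conjTranspose_mul_le`) it is at most the fidelity of the extracted state with `π ⊗ σ`.
A Stinespring isometry exists by `exists_isStinespring`.

*Randomness gives coherence* (`exists_isFibrewiseIsometric_le_sq_fidelity`). The extracted state is
purified by copying `f b` coherently into `L` and giving `A' B'` to Alice. By the other half of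
Uhlmann's theorem (`exists_contraction_traceNorm_eq`) a contraction on `A' B'` brings this
purification close to a maximally entangled state of `L` and a copy of `L`, times a purification of
`σ`. Since `L` carries `f b`, only the blocks of the contraction that respect the fibres of `f`
matter, and these complete to the Kraus operators `|a, b⟩ ↦ g k (a, b) |f b⟩` of a quantum operation
(`exists_isFibrewiseIsometric`). Such an operation keeps incoherent registers incoherent
(`IsQIP.hash_comp`) and leaves `L` in a state close to `Ψ`. Compactness of the set of contractions
replaces attainment of the minimum over `σ`.

*Attainment* (`sSup_distillationRates_QIP_mem`). The set of reachable dimensions is not empty, and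
it is bounded for `ε < 1`: a state is at most the identity, whose image has an incoherent marginal,
so that the squared fidelity with `Ψ` is at most `|A| |B| / |B'|` (`IsQIP.card_mul_sq_fidelity_le`).
-/

namespace AssistedCoherence

/-! ### Contractions and the polar decomposition -/

section Contractions

open Matrix

variable {m n k : Type*} [Fintype m] [Fintype n] [DecidableEq n]
  [Fintype k] [DecidableEq k]

/-- A product of contractions is a contraction. -/
theorem posSemidef_one_sub_conjTranspose_mul_of_mul {C : Matrix m n ℂ} {D : Matrix n k ℂ}
    (hC : (1 - Cᴴ * C).PosSemidef) (hD : (1 - Dᴴ * D).PosSemidef) :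
    (1 - (C * D)ᴴ * (C * D)).PosSemidef := by
  have h := hD.add (hC.conjTranspose_mul_mul_same D)
  convert h using 1
  simp only [conjTranspose_mul, Matrix.mul_sub, Matrix.sub_mul, Matrix.mul_one, Matrix.mul_assoc]
  abel

variable [DecidableEq m]

/-- `C` is a contraction iff `C†` is: both are the positivity of the block matrix
`[[1, C], [C†, 1]]`. -/
theorem posSemidef_one_sub_mul_conjTranspose_iff (C : Matrix m n ℂ) :
    (1 - C * Cᴴ).PosSemidef ↔ (1 - Cᴴ * C).PosSemidef := by
  let _ : Invertible (1 : Matrix m m ℂ) := invertibleOne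
  let _ : Invertible (1 : Matrix n n ℂ) := invertibleOne
  have h₁ := PosDef.fromBlocks₁₁ C (1 : Matrix n n ℂ) (A := (1 : Matrix m m ℂ)) .one
  have h₂ := PosDef.fromBlocks₂₂ (1 : Matrix m m ℂ) C (D := (1 : Matrix n n ℂ)) .one
  simp only [inv_one, Matrix.mul_one] at h₁ h₂
  exact h₂.symm.trans h₁

theorem sqrt_mul_sqrt {H : Matrix m m ℂ} (hH : H.PosSemidef) : CFC.sqrt H * CFC.sqrt H = H :=
  CFC.sqrt_mul_sqrt_self H hH.nonneg

theorem sqrt_posSemidef (H : Matrix m m ℂ) : (CFC.sqrt H).PosSemidef :=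
  nonneg_iff_posSemidef.1 (CFC.sqrt_nonneg H)

theorem sqrt_conjTranspose (H : Matrix m m ℂ) : (CFC.sqrt H)ᴴ = CFC.sqrt H :=
  (sqrt_posSemidef H).1

/-- The inverse square root of a positive semidefinite matrix on its support. -/
theorem exists_pseudoinverse_sqrt {H : Matrix m m ℂ} (hH : H.PosSemidef) :
    ∃ P : Matrix m m ℂ, Pᴴ = P ∧ H * P = CFC.sqrt H ∧ CFC.sqrt H * P * H = H ∧
      (1 - P * H * P).PosSemidef := by
  have hsa : IsSelfAdjoint H := hH.1
  have hc : ∀ g : ℝ → ℝ, ContinuousOn g (spectrum ℝ H) := fun g =>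
    finite_real_spectrum.continuousOn g
  have hpos : ∀ x ∈ spectrum ℝ H, 0 ≤ x := fun x hx => spectrum_nonneg_of_nonneg hH.nonneg hx
  have hs : CFC.sqrt H = cfc Real.sqrt H := by
    rw [CFC.sqrt_eq_real_sqrt H hH.nonneg, cfcₙ_eq_cfc (hf := Real.continuous_sqrt.continuousOn)]
  have hid : cfc (fun x : ℝ => x) H = H := cfc_id' ℝ H
  have hm : ∀ f g : ℝ → ℝ, cfc f H * cfc g H = cfc (fun x => f x * g x) H := fun f g =>
    (cfc_mul f g H (hc _) (hc _)).symm
  have hmH : ∀ f : ℝ → ℝ, cfc f H * H = cfc (fun x => f x * x) H := fun f => by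
    conv_lhs => rw [← hid]
    rw [hid, ← hm f fun x => x, hid]
  have hHm : ∀ f : ℝ → ℝ, H * cfc f H = cfc (fun x => x * f x) H := fun f => by
    rw [← hm (fun x => x) f, hid]
  refine ⟨cfc (fun x : ℝ => (√x)⁻¹) H, ?_, ?_, ?_, ?_⟩
  · exact cfc_predicate (p := IsSelfAdjoint) (fun x : ℝ => (√x)⁻¹) H
  · rw [hs, hHm]
    refine cfc_congr fun x hx => ?_
    rw [← div_eq_mul_inv, Real.div_sqrt]
  · rw [hs, hm, hmH]
    conv_rhs => rw [← hid]
    refine cfc_congr fun x hx => ?_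
    rcases eq_or_ne x 0 with rfl | h
    · simp
    · have : √x ≠ 0 := (Real.sqrt_pos.2 (lt_of_le_of_ne (hpos x hx) h.symm)).ne'
      simp [this]
  · rw [hmH, hm, ← nonneg_iff_posSemidef, ← cfc_one ℝ H, ← cfc_sub _ _ _ (hc _) (hc _)]
    refine cfc_nonneg fun x hx => ?_
    rcases eq_or_ne x 0 with rfl | h
    · simp
    · have h' : √x ≠ 0 := (Real.sqrt_pos.2 (lt_of_le_of_ne (hpos x hx) h.symm)).ne'
      have : (√x)⁻¹ * x * (√x)⁻¹ = 1 := by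
        field_simp
        exact (Real.sq_sqrt (hpos x hx)).symm
      simp [this]

/-- Left polar decomposition, with a contraction in place of the partial isometry. -/
theorem exists_polar (N : Matrix m n ℂ) :
    ∃ W : Matrix m n ℂ, (1 - Wᴴ * W).PosSemidef ∧ CFC.sqrt (N * Nᴴ) * W = N ∧
      N * Wᴴ = CFC.sqrt (N * Nᴴ) := by
  have hH := posSemidef_self_mul_conjTranspose N
  obtain ⟨P, hP, hHP, hsP, h1⟩ := exists_pseudoinverse_sqrt hH
  refine ⟨P * N, ?_, ?_, ?_⟩
  · rw [← posSemidef_one_sub_mul_conjTranspose_iff]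
    simpa only [conjTranspose_mul, hP, Matrix.mul_assoc] using h1
  · have : (CFC.sqrt (N * Nᴴ) * P - 1) * (N * Nᴴ) = 0 := by
      rw [Matrix.sub_mul, hsP, Matrix.one_mul, sub_self]
    rw [← Matrix.mul_assoc, Matrix.mul_assoc, Matrix.mul_self_mul_conjTranspose_eq_zero,
      Matrix.sub_mul, Matrix.one_mul, sub_eq_zero, Matrix.mul_assoc] at this
    exact this
  · rw [conjTranspose_mul, hP, ← Matrix.mul_assoc, hHP]

end Contractions

/-! ### The trace norm and overlaps of purifications -/

section TraceNorm

open Matrix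

variable {m n k : Type*} [Fintype m] [Fintype n] [Fintype k]

theorem norm_sum_mul_sq_le {ι : Type*} (s : Finset ι) (u v : ι → ℂ) :
    ‖∑ i ∈ s, u i * v i‖ ^ 2 ≤ (∑ i ∈ s, ‖u i‖ ^ 2) * ∑ i ∈ s, ‖v i‖ ^ 2 := by
  calc ‖∑ i ∈ s, u i * v i‖ ^ 2 ≤ (∑ i ∈ s, ‖u i‖ * ‖v i‖) ^ 2 := by
        gcongr
        exact (norm_sum_le _ _).trans_eq (by simp)
    _ ≤ _ := Finset.sum_mul_sq_le_sq_mul_sq _ _ _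

theorem re_trace_conjTranspose_mul_self (A : Matrix m n ℂ) :
    (Aᴴ * A).trace.re = ∑ p : n × m, ‖A p.2 p.1‖ ^ 2 := by
  simp only [trace, diag, mul_apply, conjTranspose_apply, Fintype.sum_prod_type, Complex.re_sum]
  refine Finset.sum_congr rfl fun i _ => Finset.sum_congr rfl fun j _ => ?_
  rw [Complex.star_def, Complex.conj_mul', ← Complex.ofReal_pow, Complex.ofReal_re]

/-- The Cauchy-Schwarz inequality for the Hilbert-Schmidt inner product. -/
theorem norm_trace_conjTranspose_mul_sq_le (A B : Matrix m n ℂ) :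
    ‖(Aᴴ * B).trace‖ ^ 2 ≤ (Aᴴ * A).trace.re * (Bᴴ * B).trace.re := by
  rw [re_trace_conjTranspose_mul_self, re_trace_conjTranspose_mul_self]
  have h := norm_sum_mul_sq_le Finset.univ (fun p : n × m => star (A p.2 p.1)) fun p => B p.2 p.1
  simp only [norm_star] at h
  convert h using 3
  simp [trace, mul_apply, Fintype.sum_prod_type]

variable [DecidableEq m] [DecidableEq k]

theorem norm_trace_mul_le_of_posSemidef {S C : Matrix m m ℂ} (hS : S.PosSemidef)
    (hC : (1 - Cᴴ * C).PosSemidef) : ‖(S * C).trace‖ ≤ S.trace.re := by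
  set Q := CFC.sqrt S with hQ
  have hQQ : Q * Q = S := sqrt_mul_sqrt hS
  have hQh : Qᴴ = Q := sqrt_conjTranspose S
  have h := norm_trace_conjTranspose_mul_sq_le Q (C * Q)
  have h0 : 0 ≤ S.trace.re := (Complex.le_def.1 hS.trace_nonneg).1
  have h2 : ((C * Q)ᴴ * (C * Q)).trace.re ≤ S.trace.re := by
    have := (Complex.le_def.1 (hC.conjTranspose_mul_mul_same Q).trace_nonneg).1
    simp only [Matrix.mul_sub, Matrix.sub_mul, trace_sub, Matrix.mul_one, hQh, hQQ,
      Complex.sub_re, Complex.zero_re, sub_nonneg] at this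
    simpa only [conjTranspose_mul, hQh, Matrix.mul_assoc] using this
  have h3 : (Qᴴ * (C * Q)).trace = (S * C).trace := by
    rw [hQh, ← Matrix.mul_assoc, trace_mul_comm, ← Matrix.mul_assoc, hQQ]
  rw [h3, hQh, hQQ] at h
  refine abs_le_of_sq_le_sq' (h.trans ?_) h0 |>.2
  rw [sq]
  gcongr

/-- The trace norm dominates the overlap with every contraction. -/
theorem norm_trace_mul_le_traceNorm (M : Matrix m m ℂ) {K : Matrix m m ℂ}
    (hK : (1 - Kᴴ * K).PosSemidef) : ‖(M * K).trace‖ ≤ traceNorm M := by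
  obtain ⟨W, hW, hWM, -⟩ := exists_polar Mᴴ
  rw [conjTranspose_conjTranspose] at hWM
  have hM : M = Wᴴ * CFC.sqrt (Mᴴ * M) := by
    have := congrArg conjTranspose hWM
    rw [conjTranspose_mul, conjTranspose_conjTranspose, sqrt_conjTranspose] at this
    exact this.symm
  have hW' : (1 - (Wᴴ)ᴴ * Wᴴ).PosSemidef := by
    rwa [conjTranspose_conjTranspose, posSemidef_one_sub_mul_conjTranspose_iff]
  have h := norm_trace_mul_le_of_posSemidef (sqrt_posSemidef (Mᴴ * M))
    (posSemidef_one_sub_conjTranspose_mul_of_mul hK hW')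
  have e : (M * K).trace = (CFC.sqrt (Mᴴ * M) * (K * Wᴴ)).trace := by
    conv_lhs => rw [hM, Matrix.mul_assoc, trace_mul_comm, Matrix.mul_assoc]
  rw [e]
  exact h

/-- The easy half of Uhlmann's theorem: the overlap of any two purifications (written as matrices)
is at most the fidelity. -/
theorem norm_trace_conjTranspose_mul_le (X Y : Matrix m k ℂ) :
    ‖(Xᴴ * Y).trace‖ ≤ traceNorm (CFC.sqrt (X * Xᴴ) * CFC.sqrt (Y * Yᴴ)) := by
  obtain ⟨C, hC, hX, -⟩ := exists_polar X
  obtain ⟨D, hD, hY, -⟩ := exists_polar Y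
  have hC' : (1 - (Cᴴ)ᴴ * Cᴴ).PosSemidef := by
    rwa [conjTranspose_conjTranspose, posSemidef_one_sub_mul_conjTranspose_iff]
  have h := norm_trace_mul_le_traceNorm (CFC.sqrt (X * Xᴴ) * CFC.sqrt (Y * Yᴴ))
    (posSemidef_one_sub_conjTranspose_mul_of_mul hD hC')
  have e : (Xᴴ * Y).trace
      = (CFC.sqrt (X * Xᴴ) * CFC.sqrt (Y * Yᴴ) * (D * Cᴴ)).trace := by
    have hX' : Xᴴ = Cᴴ * CFC.sqrt (X * Xᴴ) := by
      rw [← sqrt_conjTranspose (X * Xᴴ), ← conjTranspose_mul, hX]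
    have hXY : Xᴴ * Y = Cᴴ * CFC.sqrt (X * Xᴴ) * (CFC.sqrt (Y * Yᴴ) * D) := by rw [hY, ← hX']
    rw [hXY, Matrix.mul_assoc, trace_mul_comm]
    simp only [Matrix.mul_assoc]
  rw [e]
  exact h

/-- The other half of Uhlmann's theorem: the fidelity is reached by a contraction acting on the
purifying system. -/
theorem exists_contraction_traceNorm_eq (X : Matrix m k ℂ) (σ : Matrix m m ℂ) :
    ∃ Z : Matrix k m ℂ, (1 - Zᴴ * Z).PosSemidef ∧
      traceNorm (CFC.sqrt (X * Xᴴ) * CFC.sqrt σ) = (CFC.sqrt σ * X * Z).trace.re := by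
  obtain ⟨W, hW, -, hNW⟩ := exists_polar (CFC.sqrt σ * X)
  refine ⟨Wᴴ, ?_, ?_⟩
  · rwa [conjTranspose_conjTranspose, posSemidef_one_sub_mul_conjTranspose_iff]
  · rw [hNW, traceNorm]
    congr 3
    simp only [conjTranspose_mul, sqrt_conjTranspose]
    rw [Matrix.mul_assoc, ← Matrix.mul_assoc (CFC.sqrt (X * Xᴴ)),
      sqrt_mul_sqrt (posSemidef_self_mul_conjTranspose X)]
    simp only [Matrix.mul_assoc]

end TraceNorm

/-! ### Quantum operations -/

section Channels

open Matrix

variable {m n k ι : Type*} [Fintype m] [Fintype ι]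

/-- The completely positive map `X ↦ ∑ i, κ i X (κ i)†` with Kraus operators `κ`. -/
noncomputable def krausMap (κ : ι → Matrix n m ℂ) : Matrix m m ℂ →ₗ[ℂ] Matrix n n ℂ where
  toFun X := ∑ i, κ i * X * (κ i)ᴴ
  map_add' X Y := by simp [Matrix.mul_add, Matrix.add_mul, Finset.sum_add_distrib]
  map_smul' c X := by simp [Finset.smul_sum]

theorem krausMap_apply (κ : ι → Matrix n m ℂ) (X : Matrix m m ℂ) (x y : n) :
    krausMap κ X x y = ∑ i, ∑ p, ∑ q, κ i x p * X p q * star (κ i y q) := by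
  simp only [krausMap, LinearMap.coe_mk, AddHom.coe_mk, Matrix.sum_apply, mul_apply,
    conjTranspose_apply, Finset.sum_mul]
  exact Finset.sum_congr rfl fun i _ => Finset.sum_comm

variable [Fintype n] [Fintype k]

theorem IsChannel.comp {Φ : Matrix n n ℂ →ₗ[ℂ] Matrix k k ℂ} {Λ : Matrix m m ℂ →ₗ[ℂ] Matrix n n ℂ}
    (hΦ : IsChannel Φ) (hΛ : IsChannel Λ) : IsChannel (Φ ∘ₗ Λ) :=
  ⟨fun d M hM => hΦ.1 d _ (hΛ.1 d M hM), fun X => (hΦ.2 _).trans (hΛ.2 X)⟩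

theorem IsChannel.posSemidef {Φ : Matrix m m ℂ →ₗ[ℂ] Matrix n n ℂ} (hΦ : IsChannel Φ)
    {X : Matrix m m ℂ} (hX : X.PosSemidef) : (Φ X).PosSemidef := by
  have h := hΦ.1 1 _ (hX.submatrix (Prod.fst : m × Fin 1 → m))
  exact h.submatrix fun x => (x, 0)

theorem IsChannel.isState {Φ : Matrix m m ℂ →ₗ[ℂ] Matrix n n ℂ} (hΦ : IsChannel Φ)
    {X : Matrix m m ℂ} (hX : IsState X) : IsState (Φ X) :=
  ⟨hΦ.posSemidef hX.1, (hΦ.2 X).trans hX.2⟩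

variable [DecidableEq m]

theorem isChannel_krausMap {κ : ι → Matrix n m ℂ} (h : ∑ i, (κ i)ᴴ * κ i = 1) :
    IsChannel (krausMap κ) := by
  refine ⟨fun d M hM => ?_, fun X => ?_⟩
  · have e : ampliation (krausMap κ) (Fin d) M
        = ∑ i, (κ i ⊗ₖ (1 : Matrix (Fin d) (Fin d) ℂ)) * M *
          (κ i ⊗ₖ (1 : Matrix (Fin d) (Fin d) ℂ))ᴴ := by
      ext ⟨x, s⟩ ⟨y, t⟩
      simp only [ampliation, of_apply, krausMap_apply, Matrix.sum_apply, mul_apply,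
        conjTranspose_apply, kroneckerMap_apply, Fintype.sum_prod_type, one_apply, mul_ite,
        ite_mul, mul_one, mul_zero, zero_mul, Finset.sum_ite_eq, Finset.mem_univ, if_true,
        apply_ite star, star_zero, Finset.sum_mul]
      exact Finset.sum_congr rfl fun i _ => Finset.sum_comm
    rw [e]
    exact posSemidef_sum _ fun i _ => hM.mul_mul_conjTranspose_same _
  · simp only [krausMap, LinearMap.coe_mk, AddHom.coe_mk, trace_sum]
    calc ∑ i, (κ i * X * (κ i)ᴴ).trace = ∑ i, ((κ i)ᴴ * κ i * X).trace :=
          Finset.sum_congr rfl fun i _ => by rw [trace_mul_comm, ← Matrix.mul_assoc]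
      _ = X.trace := by rw [← trace_sum, ← Finset.sum_mul, h, Matrix.one_mul]

/-- Every quantum operation has a Stinespring isometry. Its blocks are the Kraus operators, which
are read off a square root of the Choi matrix. -/
theorem exists_isStinespring {Φ : Matrix m m ℂ →ₗ[ℂ] Matrix n n ℂ} (hΦ : IsChannel Φ) :
    ∃ (e : ℕ) (U : Matrix (n × Fin e) m ℂ), IsStinespring U Φ := by
  classical
  let g := Fintype.equivFin m
  let g' := Fintype.equivFin (n × Fin (Fintype.card m))
  set C := ampliation Φ (Fin (Fintype.card m))
    (ketbra fun x : m × Fin (Fintype.card m) => if g x.1 = x.2 then (1 : ℂ) else 0) with hC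
  have hCp : C.PosSemidef := hΦ.1 _ _ (posSemidef_vecMulVec_self_star _)
  have hCe : ∀ x y i j, C (x, g i) (y, g j) = Φ (Matrix.single i j 1) x y := by
    intro x y i j
    rw [hC]
    simp only [ampliation, of_apply]
    have hs : (of fun p q => ketbra (fun x : m × Fin (Fintype.card m) =>
        if g x.1 = x.2 then (1 : ℂ) else 0) (p, g i) (q, g j)) = Matrix.single i j 1 := by
      ext p q
      by_cases hp : i = p <;> by_cases hq : j = q <;>
        simp [ketbra, vecMulVec_apply, hp, hq, eq_comm]
    rw [hs]
  set Q := CFC.sqrt C with hQ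
  have hQQ : ∀ u v, ∑ w, Q u w * star (Q v w) = C u v := by
    intro u v
    have := congrFun (congrFun (sqrt_mul_sqrt hCp) u) v
    rw [← this, mul_apply]
    refine Finset.sum_congr rfl fun w _ => ?_
    rw [← conjTranspose_apply, sqrt_conjTranspose]
  let U : Matrix (n × Fin (Fintype.card (n × Fin (Fintype.card m)))) m ℂ :=
    of fun x i => Q (x.1, g i) (g'.symm x.2)
  have hU : ∀ x y i j, ∑ w, U (x, w) i * star (U (y, w) j) = Φ (Matrix.single i j 1) x y := by
    intro x y i j
    rw [← hCe, ← hQQ, ← g'.symm.sum_comp]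
    rfl
  refine ⟨_, U, ?_, fun X => ?_⟩
  · ext j i
    have := hΦ.2 (Matrix.single i j 1)
    simp only [trace, diag, ← hU] at this
    simp only [mul_apply, conjTranspose_apply, Fintype.sum_prod_type]
    calc _ = ∑ x, ∑ w, U (x, w) i * star (U (x, w) j) := by simp only [mul_comm]
      _ = _ := by
        rw [this]
        by_cases h : i = j <;> simp [Matrix.single_apply, one_apply, h, ite_and]
  · ext x y
    conv_lhs => rw [matrix_eq_sum_single X]
    have hs : ∀ i j, Matrix.single i j (X i j) = X i j • Matrix.single i j (1 : ℂ) := by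
      intro i j; simp
    simp only [map_sum, hs, map_smul, Matrix.sum_apply, Matrix.smul_apply, ← hU, traceSnd,
      of_apply, mul_apply, conjTranspose_apply, smul_eq_mul, Finset.mul_sum, Finset.sum_mul]
    rw [Finset.sum_comm]
    conv_rhs => rw [Finset.sum_comm]
    refine Finset.sum_congr rfl fun j _ => ?_
    rw [Finset.sum_comm]
    refine Finset.sum_congr rfl fun i _ => Finset.sum_congr rfl fun w _ => ?_
    ring

end Channels

/-! ### Purified distance to pure and to product states -/

section Distance

open Matrix

variable {m n : Type*} [Fintype m] [Fintype n]

theorem IsState.kronecker {ρ : Matrix m m ℂ} {σ : Matrix n n ℂ} (hρ : IsState ρ)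
    (hσ : IsState σ) : IsState (ρ ⊗ₖ σ) :=
  ⟨hρ.1.kronecker hσ.1, by rw [trace_kronecker, hρ.2, hσ.2, one_mul]⟩

variable [DecidableEq m] [DecidableEq n]

theorem fidelity_eq_traceNorm {ρ : Matrix m m ℂ} (hρ : IsState ρ) (σ : Matrix m m ℂ) :
    fidelity ρ σ = traceNorm (CFC.sqrt ρ * CFC.sqrt σ) := by
  simp [fidelity, hρ.2]

theorem purifiedDistance_le_iff {ρ σ : Matrix m m ℂ} {ε : ℝ} (hε : 0 ≤ ε) :
    purifiedDistance ρ σ ≤ ε ↔ 1 - ε ^ 2 ≤ fidelity ρ σ ^ 2 := by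
  rw [purifiedDistance, Real.sqrt_le_left hε]
  constructor <;> intro h <;> linarith

theorem purifiedDistance_le_one (ρ σ : Matrix m m ℂ) : purifiedDistance ρ σ ≤ 1 :=
  (purifiedDistance_le_iff zero_le_one).2 (by nlinarith [sq_nonneg (fidelity ρ σ)])

/-- The fidelity with a pure state, `F(ω, |v⟩⟨v|)² = ⟨v|ω|v⟩`. -/
theorem sq_traceNorm_sqrt_mul_sqrt_ketbra {ω : Matrix m m ℂ} (hω : ω.PosSemidef) {v : m → ℂ}
    (hv : star v ⬝ᵥ v = 1) :
    traceNorm (CFC.sqrt ω * CFC.sqrt (ketbra v)) ^ 2 = (star v ⬝ᵥ ω *ᵥ v).re := by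
  have hP : (ketbra v).PosSemidef := posSemidef_vecMulVec_self_star v
  have hPP : ketbra v * ketbra v = ketbra v := by
    rw [ketbra, vecMulVec_mul_vecMulVec, hv, one_smul]
  have hs : CFC.sqrt (ketbra v) = ketbra v := CFC.sqrt_unique hPP hP.nonneg
  set c := star v ⬝ᵥ ω *ᵥ v with hc
  have hc0 : 0 ≤ c := hω.dotProduct_mulVec_nonneg v
  have hcr : c = ((√c.re * √c.re : ℝ) : ℂ) := by
    rw [Real.mul_self_sqrt (Complex.le_def.1 hc0).1]
    exact Complex.ext rfl (Complex.le_def.1 hc0).2.symm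
  have hM : (CFC.sqrt ω * ketbra v)ᴴ * (CFC.sqrt ω * ketbra v) = c • ketbra v := by
    rw [conjTranspose_mul, sqrt_conjTranspose, Matrix.mul_assoc, ← Matrix.mul_assoc (CFC.sqrt ω),
      sqrt_mul_sqrt hω, hP.1.eq, ketbra, mul_vecMulVec, vecMulVec_mul_vecMulVec, ← hc,
      vecMulVec_smul]
  have hr : CFC.sqrt (c • ketbra v) = ((√c.re : ℝ) : ℂ) • ketbra v := by
    refine CFC.sqrt_unique ?_ (hP.smul ?_).nonneg
    · rw [smul_mul_smul_comm, hPP, ← Complex.ofReal_mul, ← hcr]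
    · exact_mod_cast Real.sqrt_nonneg _
  have ht : (ketbra v).trace = 1 := by
    rw [ketbra, trace_vecMulVec, dotProduct_comm, hv]
  rw [traceNorm, hs, hM, hr, trace_smul, ht, smul_eq_mul, mul_one, Complex.ofReal_re,
    Real.sq_sqrt (Complex.le_def.1 hc0).1]

theorem sqrt_inv_mul_sqrt_inv (m : Type*) [Fintype m] :
    (((1 / √(Fintype.card m : ℝ) : ℝ) : ℂ) * ((1 / √(Fintype.card m : ℝ) : ℝ) : ℂ))
      = (Fintype.card m : ℂ)⁻¹ := by
  rw [← Complex.ofReal_mul, div_mul_div_comm, one_mul, Real.mul_self_sqrt (Nat.cast_nonneg _)]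
  simp

theorem star_mcsVector_dotProduct (m : Type*) [Fintype m] [Nonempty m] :
    star (mcsVector m) ⬝ᵥ mcsVector m = 1 := by
  have : (Fintype.card m : ℂ) ≠ 0 := by simp
  simp only [dotProduct, mcsVector, Pi.star_apply, Complex.star_def, Complex.conj_ofReal,
    sqrt_inv_mul_sqrt_inv, Finset.sum_const, Finset.card_univ, nsmul_eq_mul]
  field_simp

/-- The squared fidelity with the maximally coherent state is the average entry. -/
theorem sq_fidelity_mcs [Nonempty m] {ω : Matrix m m ℂ} (hω : IsState ω) :
    fidelity ω (mcs m) ^ 2 = (Fintype.card m : ℝ)⁻¹ * (∑ x, ∑ y, ω x y).re := by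
  rw [fidelity_eq_traceNorm hω, mcs,
    sq_traceNorm_sqrt_mul_sqrt_ketbra hω.1 (star_mcsVector_dotProduct m)]
  have : star (mcsVector m) ⬝ᵥ ω *ᵥ mcsVector m
      = (((Fintype.card m : ℝ)⁻¹ : ℝ) : ℂ) * ∑ x, ∑ y, ω x y := by
    simp only [dotProduct, mulVec, mcsVector, Pi.star_apply, Complex.star_def, Complex.conj_ofReal,
      Finset.mul_sum]
    refine Finset.sum_congr rfl fun x _ => Finset.sum_congr rfl fun y _ => ?_
    rw [Complex.ofReal_inv, Complex.ofReal_natCast, ← sqrt_inv_mul_sqrt_inv]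
    ring
  rw [this, Complex.re_ofReal_mul]

theorem isState_maximallyMixed (m : Type*) [Fintype m] [DecidableEq m] [Nonempty m] :
    IsState (maximallyMixed m) := by
  refine ⟨PosSemidef.one.smul ?_, ?_⟩
  · rw [← Complex.ofReal_natCast, ← Complex.ofReal_inv]
    exact_mod_cast inv_nonneg.2 (Nat.cast_nonneg _)
  · rw [maximallyMixed, trace_smul, trace_one, smul_eq_mul, inv_mul_cancel₀]
    simp

/-- `√(π ⊗ σ) = dim^{-1/2} (1 ⊗ √σ)`. -/
theorem sqrt_maximallyMixed_kronecker {σ : Matrix n n ℂ} (hσ : σ.PosSemidef) :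
    CFC.sqrt (maximallyMixed m ⊗ₖ σ) =
      ((1 / √(Fintype.card m : ℝ) : ℝ) : ℂ) • ((1 : Matrix m m ℂ) ⊗ₖ CFC.sqrt σ) := by
  refine CFC.sqrt_unique ?_ ((PosSemidef.one.kronecker (sqrt_posSemidef σ)).smul ?_).nonneg
  · rw [smul_mul_smul_comm, sqrt_inv_mul_sqrt_inv, ← mul_kronecker_mul, sqrt_mul_sqrt hσ,
      Matrix.one_mul, maximallyMixed, smul_kronecker]
  · exact_mod_cast div_nonneg zero_le_one (Real.sqrt_nonneg _)

theorem IsState.one_sub_posSemidef {ρ : Matrix m m ℂ} (hρ : IsState ρ) : (1 - ρ).PosSemidef := by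
  set Q := CFC.sqrt ρ with hQ
  have hQQ : Q * Qᴴ = ρ := by rw [sqrt_conjTranspose, sqrt_mul_sqrt hρ.1]
  have htr : ∑ p : m × m, ‖Q p.2 p.1‖ ^ 2 = 1 := by
    rw [← re_trace_conjTranspose_mul_self, trace_mul_comm, hQQ, hρ.2, Complex.one_re]
  rw [← hQQ, posSemidef_one_sub_mul_conjTranspose_iff, posSemidef_iff_dotProduct_mulVec]
  refine ⟨isHermitian_one.sub (isHermitian_conjTranspose_mul_self Q), fun x => ?_⟩
  have hn : ∀ y : m → ℂ, star y ⬝ᵥ y = ((∑ i, ‖y i‖ ^ 2 : ℝ) : ℂ) := by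
    intro y
    simp [dotProduct, Complex.conj_mul']
  have e : star x ⬝ᵥ ((1 - Qᴴ * Q) *ᵥ x) = star x ⬝ᵥ x - star (Q *ᵥ x) ⬝ᵥ (Q *ᵥ x) := by
    rw [sub_mulVec, one_mulVec, dotProduct_sub, star_mulVec, ← dotProduct_mulVec, mulVec_mulVec]
  rw [e, hn, hn, sub_nonneg, Complex.real_le_real]
  calc ∑ i, ‖(Q *ᵥ x) i‖ ^ 2 ≤ ∑ i, (∑ j, ‖Q i j‖ ^ 2) * ∑ j, ‖x j‖ ^ 2 :=
        Finset.sum_le_sum fun i _ => norm_sum_mul_sq_le _ _ _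
    _ = ∑ j, ‖x j‖ ^ 2 := by
        rw [← Finset.sum_mul, Finset.sum_comm,
          ← Fintype.sum_prod_type (fun p : m × m => ‖Q p.2 p.1‖ ^ 2), htr, one_mul]

end Distance

/-! ### Quantum-incoherent states and hashing channels -/

section QuantumIncoherent

open Matrix

variable {A B A' B' L ι : Type*} [Fintype A] [Fintype B]

theorem sum_sum_sum_comm {α β γ M : Type*} [Fintype α] [Fintype β] [Fintype γ] [AddCommMonoid M]
    (F : α → β → γ → M) : ∑ x, ∑ y, ∑ z, F x y z = ∑ z, ∑ x, ∑ y, F x y z :=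
  (Finset.sum_congr rfl fun _ _ => Finset.sum_comm).trans Finset.sum_comm

theorem isState_traceFst {σ : Matrix (A × B) (A × B) ℂ} (hσ : IsState σ) :
    IsState (traceFst σ) := by
  refine ⟨?_, ?_⟩
  · have : traceFst σ = ∑ a, σ.submatrix (fun b => (a, b)) fun b => (a, b) := by
      ext i j
      simp [traceFst, Matrix.sum_apply]
    rw [this]
    exact posSemidef_sum _ fun a _ => hσ.1.submatrix _
  · rw [← hσ.2]
    simp only [trace, diag, traceFst, of_apply, Fintype.sum_prod_type]
    exact Finset.sum_comm

variable [DecidableEq A] [DecidableEq B] [Fintype A'] [DecidableEq A'] [Fintype B']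
  [DecidableEq B'] [Fintype L] [DecidableEq L]
  [Fintype ι]

theorem isState_of_mem_QI {σ : Matrix (A × B) (A × B) ℂ} (hσ : σ ∈ QI A B) : IsState σ := by
  obtain ⟨p, τ, hp, hp1, hτ, rfl⟩ := hσ
  have hs : ∀ b : B, (Matrix.single b b (1 : ℂ)).PosSemidef := fun b => by
    rw [single_eq_single_vecMulVec_single]
    simpa using posSemidef_vecMulVec_self_star (Pi.single b (1 : ℂ))
  refine ⟨posSemidef_sum _ fun b _ => ((hτ b).1.kronecker (hs b)).smul ?_, ?_⟩
  · exact_mod_cast hp b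
  · simp only [trace_sum, trace_smul, trace_kronecker, (hτ _).2, trace_single_eq_same, smul_eq_mul,
      mul_one]
    exact_mod_cast hp1

theorem apply_eq_zero_of_mem_QI {σ : Matrix (A × B) (A × B) ℂ} (hσ : σ ∈ QI A B) {x y : A × B}
    (h : x.2 ≠ y.2) : σ x y = 0 := by
  obtain ⟨p, τ, -, -, -, rfl⟩ := hσ
  rw [Matrix.sum_apply]
  refine Finset.sum_eq_zero fun b _ => ?_
  have : ¬(b = x.2 ∧ b = y.2) := fun hb => h (hb.1.symm.trans hb.2)
  simp [this]

theorem maximallyMixed_mem_QI [Nonempty A] [Nonempty B] : maximallyMixed (A × B) ∈ QI A B := by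
  have hB : (Fintype.card B : ℝ) ≠ 0 := by simp
  refine ⟨fun _ => (Fintype.card B : ℝ)⁻¹, fun _ => maximallyMixed A,
    fun _ => inv_nonneg.2 (Nat.cast_nonneg _), ?_, fun _ => isState_maximallyMixed A, ?_⟩
  · simp [hB]
  · ext ⟨a, b⟩ ⟨a', b'⟩
    by_cases h : b = b' <;> by_cases h' : a = a' <;>
      simp [maximallyMixed, Matrix.sum_apply, Matrix.single_apply, one_apply, h, h', ite_and]

/-- With a trivial first factor, the quantum-incoherent states are the diagonal states. -/
theorem mem_QI_of_apply_eq_zero {σ : Matrix (Fin 1 × B) (Fin 1 × B) ℂ} (hσ : IsState σ)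
    (h : ∀ x y : Fin 1 × B, x.2 ≠ y.2 → σ x y = 0) : σ ∈ QI (Fin 1) B := by
  have hre : ∀ b, (((σ (0, b) (0, b)).re : ℝ) : ℂ) = σ (0, b) (0, b) := fun b =>
    Complex.ext rfl (Complex.le_def.1 (hσ.1.diag_nonneg (i := (0, b)))).2
  refine ⟨fun b => (σ (0, b) (0, b)).re, fun _ => 1,
    fun b => (Complex.le_def.1 (hσ.1.diag_nonneg (i := (0, b)))).1, ?_,
    fun _ => ⟨PosSemidef.one, by simp⟩, ?_⟩
  · have := congrArg Complex.re hσ.2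
    simpa [trace, Fintype.sum_prod_type] using this
  · ext ⟨a, b⟩ ⟨a', b'⟩
    obtain rfl := Subsingleton.elim a 0
    obtain rfl := Subsingleton.elim a' 0
    by_cases hb : b = b'
    · subst hb
      simp [hre, Matrix.sum_apply, Matrix.single_apply]
    · rw [h _ _ hb]
      simp [Matrix.sum_apply, Matrix.single_apply, hb, ite_and]

/-- The Kraus operators `|a, b⟩ ↦ g k (a, b) |f b⟩`, which measure the first factor together with
the part of the second one that is not kept by the hash function `f`. The first output factor is
trivial. -/
noncomputable def hashKraus (f : B → L) (g : ι → A × B → ℂ) (k : ι) :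
    Matrix (Fin 1 × L) (A × B) ℂ :=
  of fun x p => if f p.2 = x.2 then g k p else 0

/-- The orthonormality condition on amplitudes that makes `hashKraus` trace preserving: on each
fibre of `f`, the amplitudes form an isometry. -/
def IsFibrewiseIsometric (f : B → L) (g : ι → A × B → ℂ) : Prop :=
  ∀ p q : A × B, f p.2 = f q.2 → ∑ k, star (g k p) * g k q = if p = q then 1 else 0

theorem isChannel_krausMap_hashKraus {f : B → L} {g : ι → A × B → ℂ}
    (hg : IsFibrewiseIsometric f g) : IsChannel (krausMap (hashKraus f g)) := by
  refine isChannel_krausMap ?_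
  ext p q
  simp only [Matrix.sum_apply, mul_apply, conjTranspose_apply, hashKraus, of_apply,
    Fintype.sum_prod_type, Finset.univ_unique, Finset.sum_singleton, apply_ite star, star_zero,
    ite_mul, mul_ite, zero_mul, mul_zero, Finset.sum_ite_eq, Finset.mem_univ, if_true]
  by_cases h : f p.2 = f q.2
  · simp only [h, if_true, hg p q h, one_apply]
  · have : p ≠ q := fun hpq => h (by rw [hpq])
    simp [h, one_apply, this]

/-- Hashing with fibrewise isometric amplitudes maps quantum-incoherent states to incoherent
states, so it may follow any quantum-incoherent-state-preserving operation. -/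
theorem IsQIP.hash_comp {Λ : BipartiteMap A B A' B'} (hΛ : IsQIP Λ) {f : B' → L}
    {g : ι → A' × B' → ℂ} (hg : IsFibrewiseIsometric f g) :
    IsQIP (A' := Fin 1) (krausMap (hashKraus f g) ∘ₗ Λ) := by
  refine ⟨(isChannel_krausMap_hashKraus hg).comp hΛ.1, fun σ hσ => ?_⟩
  have h := hΛ.2 σ hσ
  refine mem_QI_of_apply_eq_zero
    ((isChannel_krausMap_hashKraus hg).isState (isState_of_mem_QI h)) fun x y hxy => ?_
  rw [LinearMap.comp_apply, krausMap_apply]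
  refine Finset.sum_eq_zero fun k _ => Finset.sum_eq_zero fun p _ =>
    Finset.sum_eq_zero fun q _ => ?_
  by_cases hpq : p.2 = q.2
  · have : ¬(f p.2 = x.2 ∧ f q.2 = y.2) := fun hf => hxy (by rw [← hf.1, ← hf.2, hpq])
    simp only [hashKraus, of_apply]
    by_cases h₁ : f p.2 = x.2
    · have h₂ : f q.2 ≠ y.2 := fun h₂ => this ⟨h₁, h₂⟩
      simp [h₂]
    · simp [h₁]
  · simp [apply_eq_zero_of_mem_QI h hpq]

theorem isQIP_id : IsQIP (LinearMap.id : BipartiteMap A B A B) :=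
  ⟨⟨fun _ _ hM => hM, fun _ => rfl⟩, fun _ hσ => hσ⟩

/-- A quantum-incoherent-state-preserving operation cannot create much coherence, because every
state is below a multiple of the completely mixed one, whose image has an incoherent marginal. -/
theorem IsQIP.card_mul_sq_fidelity_le [Nonempty B'] {Λ : BipartiteMap A B A' B'} (hΛ : IsQIP Λ)
    {ρ : Matrix (A × B) (A × B) ℂ} (hρ : IsState ρ) :
    Fintype.card B' * fidelity (traceFst (Λ ρ)) (mcs B') ^ 2 ≤ Fintype.card (A × B) := by
  have hB' : (Fintype.card B' : ℝ) ≠ 0 := by simp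
  have hne : Nonempty (A × B) := by
    by_contra h
    rw [not_nonempty_iff] at h
    simpa [trace] using hρ.2
  obtain ⟨⟨a₀, b₀⟩⟩ := hne
  have : Nonempty A := ⟨a₀⟩
  have : Nonempty B := ⟨b₀⟩
  have hc : (Fintype.card (A × B) : ℂ) ≠ 0 := by simp
  rw [sq_fidelity_mcs (isState_traceFst (hΛ.1.isState hρ)), mul_inv_cancel_left₀ hB']
  have h1 : (1 : Matrix (A × B) (A × B) ℂ)
      = (Fintype.card (A × B) : ℂ) • maximallyMixed (A × B) := by
    rw [maximallyMixed, smul_smul, mul_inv_cancel₀ hc, one_smul]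
  have hmm := hΛ.2 _ maximallyMixed_mem_QI
  have hpos := hΛ.1.posSemidef hρ.one_sub_posSemidef
  -- the positivity of `Λ (1 - ρ)`, tested on the unnormalised maximally coherent vectors
  have hsum : 0 ≤ ∑ a, ∑ x, ∑ y, Λ (1 - ρ) (a, x) (a, y) := by
    refine Finset.sum_nonneg fun a _ => ?_
    have := (hpos.submatrix fun b => (a, b)).dotProduct_mulVec_nonneg fun _ => (1 : ℂ)
    simpa [dotProduct, mulVec] using this
  have hinc : ∑ a, ∑ x, ∑ y, Λ 1 (a, x) (a, y) = Fintype.card (A × B) := by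
    rw [h1, map_smul]
    have : ∀ a x, ∑ y, ((Fintype.card (A × B) : ℂ) • Λ (maximallyMixed (A × B))) (a, x) (a, y)
        = (Fintype.card (A × B) : ℂ) * Λ (maximallyMixed (A × B)) (a, x) (a, x) := by
      intro a x
      refine (Finset.sum_eq_single x (fun y _ hy => ?_) (by simp)).trans rfl
      rw [Matrix.smul_apply, apply_eq_zero_of_mem_QI hmm hy.symm, smul_zero]
    simp only [this, ← Finset.mul_sum]
    rw [← Fintype.sum_prod_type fun p : A' × B' => Λ (maximallyMixed (A × B)) p p]
    have ht := (isState_of_mem_QI hmm).2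
    rw [trace] at ht
    simp only [diag] at ht
    rw [ht, mul_one]
  rw [map_sub] at hsum
  simp only [Matrix.sub_apply, Finset.sum_sub_distrib, hinc, sub_nonneg] at hsum
  have hre := (Complex.le_def.1 hsum).1
  rw [Complex.natCast_re] at hre
  refine le_of_eq_of_le (congrArg Complex.re ?_) hre
  simp only [traceFst, of_apply]
  exact sum_sum_sum_comm _

end QuantumIncoherent

/-! ### The extracted state -/

section Extraction

open Matrix

variable {A B L V ι : Type*} [Fintype A] [Fintype B]

/-- The vector `φ` on `A B V` after `|b⟩ ↦ |f b⟩|b⟩`, as a matrix from the purifying system `A B`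
to `L V`. -/
def hashMatrix [DecidableEq L] (f : B → L) (φ : A × (B × V) → ℂ) : Matrix (L × V) (A × B) ℂ :=
  of fun x p => if f p.2 = x.1 then φ (p.1, (p.2, x.2)) else 0

theorem traceFst_applyHash_dephase_ketbra [DecidableEq B] [DecidableEq L] (f : B → L)
    (φ : A × (B × V) → ℂ) :
    traceFst (applyHash f (dephase (ketbra φ))) = hashMatrix f φ * (hashMatrix f φ)ᴴ := by
  ext x y
  simp only [traceFst, applyHash, dephase, ketbra, vecMulVec_apply, of_apply, mul_apply,
    conjTranspose_apply, hashMatrix, Fintype.sum_prod_type, if_true, Pi.star_apply]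
  refine Finset.sum_congr rfl fun a _ => Finset.sum_congr rfl fun b _ => ?_
  rw [ite_and]
  split_ifs <;> simp

variable [Fintype V]

/-- The state of `A B` purified by `φ`. -/
def reduced (φ : A × (B × V) → ℂ) : Matrix (A × B) (A × B) ℂ :=
  of fun p q => ∑ v, φ (p.1, (p.2, v)) * star (φ (q.1, (q.2, v)))

variable [DecidableEq L] [Fintype L]

theorem isState_hashMatrix_mul (f : B → L) {φ : A × (B × V) → ℂ} (hφ : IsState (reduced φ)) :
    IsState (hashMatrix f φ * (hashMatrix f φ)ᴴ) := by
  refine ⟨posSemidef_self_mul_conjTranspose _, ?_⟩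
  rw [← hφ.2, trace_mul_comm]
  simp only [trace, diag, mul_apply, conjTranspose_apply, hashMatrix, reduced, of_apply]
  refine Finset.sum_congr rfl fun p _ => ?_
  simp [Fintype.sum_prod_type, apply_ite star, mul_comm]

/-- The squared norm of the component along the maximally entangled state of `L` and a copy of `L`,
after the purifying system `A B` of the hashed vector has been sent by (the transpose of) `Z` to
that copy and a copy of `V`. Only the entries of `Z` that respect the fibres of `f` matter. -/
noncomputable def decouplingWeight (f : B → L) (φ : A × (B × V) → ℂ)
    (Z : Matrix (A × B) (L × V) ℂ) : ℝ :=
  (Fintype.card L : ℝ)⁻¹ * ∑ w : V × V, ‖∑ p, Z p (f p.2, w.1) * φ (p.1, (p.2, w.2))‖ ^ 2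

variable [DecidableEq A] [DecidableEq B] [DecidableEq V]

/-- Uhlmann's theorem for the extracted state and an ideal state `π ⊗ σ`. -/
theorem exists_sq_fidelity_le_decouplingWeight (f : B → L) {φ : A × (B × V) → ℂ}
    (hφ : IsState (reduced φ)) {σ : Matrix V V ℂ} (hσ : IsState σ) :
    ∃ Z : Matrix (A × B) (L × V) ℂ, (1 - Zᴴ * Z).PosSemidef ∧
      fidelity (hashMatrix f φ * (hashMatrix f φ)ᴴ) (maximallyMixed L ⊗ₖ σ) ^ 2
        ≤ decouplingWeight f φ Z := by
  obtain ⟨Z, hZ, h⟩ := exists_contraction_traceNorm_eq (hashMatrix f φ) (maximallyMixed L ⊗ₖ σ)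
  refine ⟨Z, hZ, ?_⟩
  set S := CFC.sqrt σ with hS
  have hS1 : ∑ w : V × V, ‖S w.2 w.1‖ ^ 2 = 1 := by
    rw [← re_trace_conjTranspose_mul_self, sqrt_conjTranspose, sqrt_mul_sqrt hσ.1, hσ.2,
      Complex.one_re]
  have ht : ((1 : Matrix L L ℂ) ⊗ₖ S * hashMatrix f φ * Z).trace
      = ∑ w : V × V, S w.1 w.2 * ∑ p, Z p (f p.2, w.1) * φ (p.1, (p.2, w.2)) := by
    simp only [trace, diag, mul_apply, hashMatrix, of_apply, kroneckerMap_apply, one_apply,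
      Fintype.sum_prod_type (α₁ := L), ite_mul, mul_ite, one_mul, zero_mul, mul_zero,
      Finset.sum_const_zero, Finset.sum_ite_irrel, Finset.sum_ite_eq,
      Finset.mem_univ, if_true]
    rw [Finset.sum_comm, Fintype.sum_prod_type]
    refine Finset.sum_congr rfl fun v _ => ?_
    rw [Finset.sum_comm]
    simp only [Finset.sum_ite_eq', Finset.mem_univ, if_true, Finset.sum_mul, Finset.mul_sum]
    rw [Finset.sum_comm]
    exact Finset.sum_congr rfl fun w _ => Finset.sum_congr rfl fun p _ => by ring
  rw [fidelity_eq_traceNorm (isState_hashMatrix_mul f hφ), h,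
    sqrt_maximallyMixed_kronecker hσ.1, smul_mul, smul_mul, trace_smul, smul_eq_mul,
    Complex.re_ofReal_mul, mul_pow, div_pow, one_pow, Real.sq_sqrt (Nat.cast_nonneg _),
    one_div, decouplingWeight]
  gcongr
  rw [← hS, ht, ← sq_abs]
  calc _ ≤ ‖∑ w : V × V, S w.1 w.2 * ∑ p, Z p (f p.2, w.1) * φ (p.1, (p.2, w.2))‖ ^ 2 := by
        gcongr
        exact Complex.abs_re_le_norm _
    _ ≤ (∑ w : V × V, ‖S w.1 w.2‖ ^ 2) * _ := norm_sum_mul_sq_le _ _ _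
    _ = _ := by
        rw [← (Equiv.prodComm V V).sum_comp]
        simp only [Equiv.prodComm_apply, Prod.fst_swap, Prod.snd_swap, hS1, one_mul]

theorem isCompact_contractions {m n : Type*} [Fintype m] [Fintype n] [DecidableEq n] :
    IsCompact {Z : Matrix m n ℂ | (1 - Zᴴ * Z).PosSemidef} := by
  have hpi : IsCompact (Set.univ.pi fun _ : m => Set.univ.pi fun _ : n =>
      Metric.closedBall (0 : ℂ) 1) :=
    isCompact_univ_pi fun _ => isCompact_univ_pi fun _ => isCompact_closedBall _ _
  refine IsCompact.of_isClosed_subset hpi ?_ fun Z hZ => ?_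
  · have : {Z : Matrix m n ℂ | (1 - Zᴴ * Z).PosSemidef}
        = ⋂ x : n → ℂ, {Z | 0 ≤ star x ⬝ᵥ ((1 - Zᴴ * Z) *ᵥ x)} := by
      ext Z
      simp only [Set.mem_ofPred_eq, Set.mem_iInter, posSemidef_iff_dotProduct_mulVec,
        isHermitian_one.sub (isHermitian_conjTranspose_mul_self Z), true_and]
    rw [this]
    refine isClosed_iInter fun x => isClosed_le continuous_const ?_
    fun_prop
  · refine fun i _ j _ => ?_
    rw [mem_closedBall_zero_iff]
    have h := (Complex.le_def.1 (hZ.diag_nonneg (i := j))).1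
    have e : ((1 - Zᴴ * Z : Matrix n n ℂ) j j).re = 1 - ∑ i, ‖Z i j‖ ^ 2 := by
      simp only [Matrix.sub_apply, one_apply_eq, mul_apply, conjTranspose_apply, Complex.sub_re,
        Complex.one_re, Complex.re_sum, Complex.star_def, Complex.conj_mul', ← Complex.ofReal_pow,
        Complex.ofReal_re]
    rw [e, Complex.zero_re, sub_nonneg] at h
    have h' := Finset.single_le_sum (f := fun i => ‖Z i j‖ ^ 2) (fun i _ => sq_nonneg _)
      (Finset.mem_univ i)
    exact (sq_le_one_iff₀ (norm_nonneg _)).1 (h'.trans h)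

/-- Since contractions form a compact set, one of them does as well as the infimum over `σ` that
defines the security measure; that infimum need not be known to be attained. -/
theorem exists_decouplingWeight_of_dsec_le [Nonempty V] (f : B → L) {φ : A × (B × V) → ℂ}
    (hφ : IsState (reduced φ)) {ε : ℝ} (hε : 0 ≤ ε)
    (h : dsec (hashMatrix f φ * (hashMatrix f φ)ᴴ) ≤ ε) :
    ∃ Z : Matrix (A × B) (L × V) ℂ, (1 - Zᴴ * Z).PosSemidef ∧
      1 - ε ^ 2 ≤ decouplingWeight f φ Z := by
  have hcont : Continuous (decouplingWeight f φ) := by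
    unfold decouplingWeight
    fun_prop
  obtain ⟨Z, hZ, hmax⟩ := (isCompact_contractions (m := A × B) (n := L × V)).exists_isMaxOn
    ⟨0, by simpa using PosSemidef.one⟩ hcont.continuousOn
  refine ⟨Z, hZ, ?_⟩
  have : Nonempty {σ : Matrix V V ℂ // IsState σ} := ⟨⟨_, isState_maximallyMixed V⟩⟩
  have hle : √(1 - decouplingWeight f φ Z) ≤ dsec (hashMatrix f φ * (hashMatrix f φ)ᴴ) := by
    refine le_ciInf fun σ => ?_
    obtain ⟨Z', hZ', hF⟩ := exists_sq_fidelity_le_decouplingWeight f hφ σ.2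
    exact Real.sqrt_le_sqrt (sub_le_sub_left (hF.trans (hmax hZ')) _)
  have := (Real.sqrt_le_left hε).1 (hle.trans h)
  linarith

/-- A contraction, cut down to the blocks that respect the fibres of `f`, extends to fibrewise
isometric amplitudes: the missing ones are the columns of the square root of the defect. -/
theorem exists_isFibrewiseIsometric (f : B → L) {Z : Matrix (A × B) (L × V) ℂ}
    (hZ : (1 - Zᴴ * Z).PosSemidef) :
    ∃ g : V ⊕ (A × B) → A × B → ℂ, IsFibrewiseIsometric f g ∧
      ∀ v p, g (Sum.inl v) p = Z p (f p.2, v) := by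
  set Γ : Matrix (A × B) (L × V) ℂ := of fun p x => if f p.2 = x.1 then Z p x else 0 with hΓ
  have hΓ1 : (1 - Γ * Γᴴ).PosSemidef := by
    -- `Γ = ∑ l, P l * Z * Q l`, and the projections `P l` are orthogonal
    let P : L → Matrix (A × B) (A × B) ℂ := fun l => diagonal fun p => if f p.2 = l then 1 else 0
    let Q : L → Matrix (L × V) (L × V) ℂ := fun l => diagonal fun x => if x.1 = l then 1 else 0
    have hQ : ∀ l, (1 - Z * Q l * Zᴴ).PosSemidef := fun l => by
      have h1 : (1 - Q l).PosSemidef := by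
        rw [← diagonal_one, diagonal_sub, posSemidef_diagonal_iff]
        intro x
        by_cases hx : x.1 = l <;> simp [hx]
      have := ((posSemidef_one_sub_mul_conjTranspose_iff Z).2 hZ).add
        (h1.mul_mul_conjTranspose_same Z)
      simpa [Matrix.mul_sub, Matrix.sub_mul] using this
    have hZQ : ∀ l p q, (Z * Q l * Zᴴ) p q = ∑ v, Z p (l, v) * star (Z q (l, v)) := fun l p q => by
      rw [mul_apply, Fintype.sum_prod_type]
      simp [Q, mul_diagonal]
    have e : 1 - Γ * Γᴴ = ∑ l, P l * (1 - Z * Q l * Zᴴ) * (P l)ᴴ := by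
      ext p q
      simp only [P, Matrix.sum_apply, diagonal_conjTranspose, mul_diagonal, diagonal_mul]
      by_cases h : f p.2 = f q.2
      · simp [hΓ, h, hZQ, mul_apply (M := of _), Fintype.sum_prod_type, apply_ite star]
      · have : p ≠ q := fun hpq => h (by rw [hpq])
        simp [hΓ, h, this, mul_apply, Fintype.sum_prod_type, apply_ite star]
    rw [e]
    exact posSemidef_sum _ fun l _ => (hQ l).mul_mul_conjTranspose_same _
  set R := CFC.sqrt (1 - Γ * Γᴴ) with hR
  refine ⟨Sum.elim (fun v p => Z p (f p.2, v)) fun r p => R p r, fun p q hpq => ?_, fun _ _ => rfl⟩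
  have hRR : ∑ r, star (R p r) * R q r = (1 - Γ * Γᴴ : Matrix (A × B) (A × B) ℂ) q p := by
    have := congrFun (congrFun (sqrt_mul_sqrt hΓ1) q) p
    rw [← this, mul_apply]
    refine Finset.sum_congr rfl fun r _ => ?_
    rw [mul_comm, ← conjTranspose_apply, sqrt_conjTranspose]
  have hΓΓ : (Γ * Γᴴ) q p = ∑ v, star (Z p (f p.2, v)) * Z q (f q.2, v) := by
    simp [hΓ, mul_apply, Fintype.sum_prod_type, hpq, apply_ite star, mul_comm]
  rw [Fintype.sum_sum_type]
  simp only [Sum.elim_inl, Sum.elim_inr, hRR, Matrix.sub_apply, hΓΓ, one_apply, eq_comm (a := q)]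
  ring

end Extraction

/-! ### Coherence and randomness from the same operation -/

section Protocols

open Matrix

variable {A B L V ι : Type*} [Fintype A] [Fintype B] [Fintype V]

theorem nonempty_of_isState_reduced {φ : A × (B × V) → ℂ} (hφ : IsState (reduced φ)) :
    Nonempty (A × (B × V)) := by
  by_contra h
  rw [not_nonempty_iff] at h
  have h0 := hφ.2
  have : ∀ p : A × B, reduced φ p p = 0 := fun p =>
    Finset.sum_eq_zero fun v _ => (h.false (p.1, (p.2, v))).elim
  simp [trace, this] at h0

theorem re_sum_traceFst_reduced (φ : A × (B × V) → ℂ) :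
    (∑ x, ∑ y, traceFst (reduced φ) x y).re = ∑ a, ∑ v, ‖∑ b, φ (a, (b, v))‖ ^ 2 := by
  have : ∑ x, ∑ y, traceFst (reduced φ) x y
      = ((∑ a, ∑ v, ‖∑ b, φ (a, (b, v))‖ ^ 2 : ℝ) : ℂ) := by
    push_cast
    simp only [← Complex.mul_conj', map_sum, Finset.sum_mul_sum, traceFst, reduced, of_apply,
      Complex.star_def]
    rw [sum_sum_sum_comm]
    exact Finset.sum_congr rfl fun a _ => sum_sum_sum_comm _
  rw [this, Complex.ofReal_re]

theorem re_sum_traceFst_krausMap_hashKraus [Fintype ι] [Fintype L] [DecidableEq L] (f : B → L)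
    (g : ι → A × B → ℂ) (φ : A × (B × V) → ℂ) :
    (∑ x, ∑ y, traceFst (krausMap (hashKraus f g) (reduced φ)) x y).re
      = ∑ k, ∑ v, ‖∑ p, g k p * φ (p.1, (p.2, v))‖ ^ 2 := by
  have : ∑ x, ∑ y, traceFst (krausMap (hashKraus f g) (reduced φ)) x y
      = ((∑ k, ∑ v, ‖∑ p, g k p * φ (p.1, (p.2, v))‖ ^ 2 : ℝ) : ℂ) := by
    push_cast
    simp only [← Complex.mul_conj', map_sum, Finset.sum_mul_sum, traceFst, reduced, of_apply,
      Complex.star_def, krausMap_apply, hashKraus, Finset.univ_unique, Finset.sum_singleton,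
      apply_ite (starRingEnd ℂ), map_zero, ite_mul, zero_mul, mul_ite, mul_zero]
    rw [sum_sum_sum_comm]
    refine Finset.sum_congr rfl fun k _ => ?_
    trans ∑ p, ∑ q, ∑ v, g k p * φ (p.1, (p.2, v)) * (starRingEnd ℂ) (g k q * φ (q.1, (q.2, v)))
    · rw [sum_sum_sum_comm]
      refine Finset.sum_congr rfl fun p _ => ?_
      rw [sum_sum_sum_comm]
      refine Finset.sum_congr rfl fun q _ => ?_
      simp only [Finset.sum_ite_eq, Finset.mem_univ, if_true, Finset.mul_sum, Finset.sum_mul,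
        map_mul]
      exact Finset.sum_congr rfl fun v _ => by ring
    · exact sum_sum_sum_comm _
  rw [this, Complex.ofReal_re]

variable [DecidableEq A] [DecidableEq B] [DecidableEq V]

/-- Measuring in the computational basis what could have been the maximally coherent state yields
uniform randomness: projecting the purification `φ` onto the maximally coherent state leaves Eve
with the state `σ` for which `π ⊗ σ` is close to the extracted state. -/
theorem dsec_hashMatrix_id_le {φ : A × (B × V) → ℂ} (hφ : IsState (reduced φ)) {ε : ℝ}
    (hε : 0 ≤ ε)
    (h : 1 - ε ^ 2 ≤ (Fintype.card B : ℝ)⁻¹ * ∑ a, ∑ v, ‖∑ b, φ (a, (b, v))‖ ^ 2) :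
    dsec (hashMatrix id φ * (hashMatrix id φ)ᴴ) ≤ ε := by
  obtain ⟨⟨a₀, b₀, v₀⟩⟩ := nonempty_of_isState_reduced hφ
  have : Nonempty B := ⟨b₀⟩
  have : Nonempty V := ⟨v₀⟩
  have hB : (0 : ℝ) < Fintype.card B := by exact_mod_cast Fintype.card_pos
  have hbdd : ∀ σ : {σ : Matrix V V ℂ // IsState σ},
      dsec (hashMatrix id φ * (hashMatrix id φ)ᴴ) ≤
        purifiedDistance (hashMatrix id φ * (hashMatrix id φ)ᴴ) (maximallyMixed B ⊗ₖ σ.1) :=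
    fun σ => ciInf_le ⟨0, by rintro _ ⟨_, rfl⟩; exact Real.sqrt_nonneg _⟩ σ
  set s : ℝ := ∑ a, ∑ v, ‖∑ b, φ (a, (b, v))‖ ^ 2 with hs
  have hs0 : 0 ≤ s := by positivity
  rcases hs0.eq_or_lt with hs' | hs'
  · -- no overlap at all, which is possible only for the trivial error `ε = 1`
    rw [← hs', mul_zero] at h
    refine (hbdd ⟨_, isState_maximallyMixed V⟩).trans ((purifiedDistance_le_one _ _).trans ?_)
    nlinarith
  -- `H` holds the unnormalised overlap of `φ` with the maximally coherent state of `B`, `σ` is its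
  -- normalised marginal on `V`, and `Y` is a purification of `π ⊗ σ` that overlaps well with `φ`
  let H : Matrix V A ℂ := of fun v a => ∑ b, φ (a, (b, v))
  let σ : Matrix V V ℂ := ((s⁻¹ : ℝ) : ℂ) • (H * Hᴴ)
  have hHs : (Hᴴ * H).trace.re = s := by
    rw [re_trace_conjTranspose_mul_self, Fintype.sum_prod_type]
    rfl
  have hHs' : (Hᴴ * H).trace = (s : ℂ) := by
    rw [← hHs]
    exact Complex.ext rfl
      (Complex.le_def.1 (posSemidef_conjTranspose_mul_self H).trace_nonneg).2.symm
  have hσ : IsState σ := by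
    refine ⟨(posSemidef_self_mul_conjTranspose H).smul ?_, ?_⟩
    · exact_mod_cast inv_nonneg.2 hs0
    · rw [trace_smul, trace_mul_comm, hHs', smul_eq_mul, ← Complex.ofReal_mul,
        inv_mul_cancel₀ hs'.ne', Complex.ofReal_one]
  let c : ℝ := 1 / √(Fintype.card B * s)
  have hcc : c * c = (Fintype.card B : ℝ)⁻¹ * s⁻¹ := by
    rw [div_mul_div_comm, Real.mul_self_sqrt (by positivity), one_mul, one_div, mul_inv]
  let Y := hashMatrix (L := B) id fun x : A × (B × V) => (c : ℂ) * H x.2.2 x.1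
  have hYY : Y * Yᴴ = maximallyMixed B ⊗ₖ σ := by
    ext ⟨b, v⟩ ⟨b', v'⟩
    have hcc' : (c : ℂ) * c = (Fintype.card B : ℂ)⁻¹ * (s : ℂ)⁻¹ := by
      rw [← Complex.ofReal_mul, hcc]
      simp
    rw [kroneckerMap_apply, mul_apply, Fintype.sum_prod_type]
    by_cases hb : b = b'
    · subst hb
      simp only [Y, hashMatrix, of_apply, conjTranspose_apply, id, ite_mul, zero_mul,
        Finset.sum_ite_eq', Finset.mem_univ, if_true, maximallyMixed, σ, Matrix.smul_apply,
        one_apply_eq, smul_eq_mul, mul_one, mul_apply, Finset.mul_sum]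
      refine Finset.sum_congr rfl fun a _ => ?_
      rw [star_mul', Complex.star_def, Complex.conj_ofReal, mul_mul_mul_comm, hcc',
        Complex.ofReal_inv]
      ring
    · simp [Y, hashMatrix, maximallyMixed, hb]
  have hXY : ((hashMatrix id φ)ᴴ * Y).trace = ((c * s : ℝ) : ℂ) := by
    rw [Complex.ofReal_mul, ← hHs']
    simp only [trace, diag, Y, hashMatrix, of_apply, mul_apply, conjTranspose_apply, id,
      Fintype.sum_prod_type, mul_ite, mul_zero,
      Finset.sum_ite_irrel, Finset.sum_const_zero, Finset.sum_ite_eq, Finset.mem_univ, if_true]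
    rw [Finset.mul_sum]
    refine Finset.sum_congr rfl fun a _ => ?_
    rw [Finset.sum_comm, Finset.mul_sum]
    refine Finset.sum_congr rfl fun v _ => ?_
    rw [← Finset.sum_mul, ← star_sum]
    simp only [H, of_apply]
    ring
  have hF := norm_trace_conjTranspose_mul_le (hashMatrix id φ) Y
  rw [hXY, hYY, ← fidelity_eq_traceNorm (isState_hashMatrix_mul id hφ), Complex.norm_real,
    Real.norm_eq_abs] at hF
  refine (hbdd ⟨σ, hσ⟩).trans ((purifiedDistance_le_iff hε).2 (h.trans ?_))
  calc (Fintype.card B : ℝ)⁻¹ * s = |c * s| ^ 2 := by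
        rw [sq_abs, mul_pow, sq, hcc]
        field_simp
    _ ≤ _ := by gcongr

/-- The distillation protocol built from an extraction protocol: Alice, who receives Bob's register
once the hash value has been copied, holds the purification of the extracted state, and her
measurement leaves the hash register in a nearly maximally coherent state. -/
theorem exists_isFibrewiseIsometric_le_sq_fidelity [Fintype L] [DecidableEq L] [Nonempty L]
    (f : B → L) {φ : A × (B × V) → ℂ} (hφ : IsState (reduced φ)) {ε : ℝ} (hε : 0 ≤ ε)
    (h : dsec (hashMatrix f φ * (hashMatrix f φ)ᴴ) ≤ ε) :
    ∃ g : V ⊕ (A × B) → A × B → ℂ, IsFibrewiseIsometric f g ∧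
      1 - ε ^ 2 ≤ fidelity (traceFst (krausMap (hashKraus f g) (reduced φ))) (mcs L) ^ 2 := by
  obtain ⟨⟨a₀, b₀, v₀⟩⟩ := nonempty_of_isState_reduced hφ
  have : Nonempty V := ⟨v₀⟩
  obtain ⟨Z, hZ, hle⟩ := exists_decouplingWeight_of_dsec_le f hφ hε h
  obtain ⟨g, hg, hgZ⟩ := exists_isFibrewiseIsometric f hZ
  refine ⟨g, hg, hle.trans ?_⟩
  rw [sq_fidelity_mcs (isState_traceFst ((isChannel_krausMap_hashKraus hg).isState hφ)),
    re_sum_traceFst_krausMap_hashKraus, decouplingWeight, Fintype.sum_sum_type,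
    Fintype.sum_prod_type]
  gcongr
  simp only [hgZ]
  exact le_add_of_nonneg_right (by positivity)

end Protocols

section Purification

open Matrix

variable {A B A' B' E R : Type*} [Fintype A] [DecidableEq A] [Fintype B] [DecidableEq B]
  [Fintype A'] [Fintype B'] [Fintype E] [Fintype R]

theorem reduced_outputVector {Λ : BipartiteMap A B A' B'} {U : Matrix ((A' × B') × E) (A × B) ℂ}
    (hU : IsStinespring U Λ) {ψ : (A × B) × R → ℂ} {ρ : Matrix (A × B) (A × B) ℂ}
    (hψ : IsPurification ψ ρ) : reduced (outputVector U ψ) = Λ ρ := by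
  rw [hU.2, ← hψ]
  ext p q
  simp only [reduced, outputVector, traceSnd, ketbra, of_apply, mul_apply, conjTranspose_apply,
    vecMulVec_apply, Fintype.sum_prod_type (α₁ := E), star_sum, star_mul,
    Pi.star_apply, Finset.sum_mul, Finset.mul_sum]
  refine Finset.sum_congr rfl fun e _ => ?_
  rw [← sum_sum_sum_comm]
  refine Finset.sum_congr rfl fun j _ => Finset.sum_congr rfl fun i _ =>
    Finset.sum_congr rfl fun v _ => ?_
  ring

end Purification

/-! ### The rates -/

section Rates

variable {a b r : ℕ} {ρ : Matrix (Fin a × Fin b) (Fin a × Fin b) ℂ}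
  {ψ : (Fin a × Fin b) × Fin r → ℂ} {ε : ℝ}

theorem distillationRates_subset_extractionRates (hρ : IsState ρ) (hψ : IsPurification ψ ρ)
    (hε : 0 ≤ ε) {F : BipartiteClass} (hF : ∀ a b a' b' : ℕ, ∀ Λ ∈ F a b a' b', IsChannel Λ) :
    distillationRates F ε ρ ⊆ extractionRates F ε ψ := by
  rintro _ ⟨a', b', Λ, hΛ, hP, rfl⟩
  have hc := hF _ _ _ _ _ hΛ
  obtain ⟨e, U, hU⟩ := exists_isStinespring hc
  refine ⟨a', b', Λ, hΛ, e, U, hU, b', id, ?_, rfl⟩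
  have hr := reduced_outputVector hU hψ
  have hφ : IsState (reduced (outputVector U ψ)) := hr ▸ hc.isState hρ
  obtain ⟨⟨-, b₀, -⟩⟩ := nonempty_of_isState_reduced hφ
  have : Nonempty (Fin b') := ⟨b₀⟩
  rw [extractionOutput, traceFst_applyHash_dephase_ketbra]
  refine dsec_hashMatrix_id_le hφ hε ?_
  rw [purifiedDistance_le_iff hε, ← hr, sq_fidelity_mcs (isState_traceFst hφ),
    re_sum_traceFst_reduced] at hP
  exact hP

theorem extractionRates_QIP_subset_distillationRates (hρ : IsState ρ) (hψ : IsPurification ψ ρ)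
    (hε : 0 ≤ ε) : extractionRates QIP ε ψ ⊆ distillationRates QIP ε ρ := by
  rintro _ ⟨a', b', Λ, hΛ, e, U, hU, l, f, hd, rfl⟩
  have hΛ' : IsQIP Λ := hΛ
  have hr := reduced_outputVector hU hψ
  have hφ : IsState (reduced (outputVector U ψ)) := hr ▸ hΛ'.1.isState hρ
  obtain ⟨⟨-, b₀, -⟩⟩ := nonempty_of_isState_reduced hφ
  have : Nonempty (Fin l) := ⟨f b₀⟩
  rw [extractionOutput, traceFst_applyHash_dephase_ketbra] at hd
  obtain ⟨g, hg, hle⟩ := exists_isFibrewiseIsometric_le_sq_fidelity f hφ hε hd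
  refine ⟨1, l, _, hΛ'.hash_comp hg, ?_, rfl⟩
  rw [purifiedDistance_le_iff hε, LinearMap.comp_apply, ← hr]
  exact hle

theorem distillationRates_QIP_eq_extractionRates (hρ : IsState ρ) (hψ : IsPurification ψ ρ)
    (hε : 0 ≤ ε) : distillationRates QIP ε ρ = extractionRates QIP ε ψ :=
  (distillationRates_subset_extractionRates hρ hψ hε fun _ _ _ _ _ h => h.1).antisymm
    (extractionRates_QIP_subset_distillationRates hρ hψ hε)

theorem nonempty_distillationRates_QIP (hρ : IsState ρ) (hε : 0 ≤ ε) :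
    (distillationRates QIP ε ρ).Nonempty := by
  let f : Fin b → Fin 1 := fun _ => 0
  let g : Fin a × Fin b → Fin a × Fin b → ℂ := fun k p => if k = p then 1 else 0
  have hg : IsFibrewiseIsometric f g := fun p q _ => by simp [g, eq_comm]
  have hQ := isQIP_id.hash_comp hg
  refine ⟨_, 1, 1, _, hQ, ?_, rfl⟩
  have hs := isState_traceFst (hQ.1.isState hρ)
  rw [purifiedDistance_le_iff hε, sq_fidelity_mcs hs]
  have := hs.2
  simp only [Matrix.trace, Finset.univ_unique, Finset.sum_singleton, Matrix.diag] at this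
  simp only [Finset.univ_unique, Finset.sum_singleton, this]
  simp [sq_nonneg]

theorem sSup_distillationRates_QIP_mem (hρ : IsState ρ) (hε : 0 ≤ ε) (hε1 : ε < 1) :
    sSup (distillationRates QIP ε ρ) ∈ distillationRates QIP ε ρ := by
  let S : Set ℕ := {n | ∃ (a' : ℕ) (Λ : BipartiteMap (Fin a) (Fin b) (Fin a') (Fin n)),
    IsQIP Λ ∧ purifiedDistance (traceFst (Λ ρ)) (mcs (Fin n)) ≤ ε}
  have hS : distillationRates QIP ε ρ = (fun n : ℕ => ((Real.logb 2 n : ℝ) : EReal)) '' S := by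
    ext x
    constructor
    · rintro ⟨a', n, Λ, hΛ, hP, rfl⟩
      exact ⟨n, ⟨a', Λ, hΛ, hP⟩, rfl⟩
    · rintro ⟨n, ⟨a', Λ, hΛ, hP⟩, rfl⟩
      exact ⟨a', n, Λ, hΛ, hP, rfl⟩
  have hpos : ∀ n ∈ S, 0 < n := by
    rintro n ⟨a', Λ, hΛ, -⟩
    have h := (isState_traceFst (hΛ.1.isState hρ)).2
    rcases n.eq_zero_or_pos with rfl | hn
    · simp [Matrix.trace] at h
    · exact hn
  have hδ : 0 < 1 - ε ^ 2 := by nlinarith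
  have hbdd : BddAbove S := by
    refine ⟨⌊(Fintype.card (Fin a × Fin b) : ℝ) / (1 - ε ^ 2)⌋₊, fun n hn => Nat.le_floor ?_⟩
    have : Nonempty (Fin n) := ⟨⟨0, hpos n hn⟩⟩
    obtain ⟨a', Λ, hΛ, hP⟩ := hn
    have h := hΛ.card_mul_sq_fidelity_le hρ
    rw [Fintype.card_fin] at h
    rw [le_div_iff₀ hδ]
    refine le_trans ?_ h
    gcongr
    exact (purifiedDistance_le_iff hε).1 hP
  have hne : S.Nonempty := by
    have := nonempty_distillationRates_QIP hρ hε
    rw [hS] at this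
    exact Set.image_nonempty.1 this
  have hmem := Nat.sSup_mem hne hbdd
  have hgr : IsGreatest (distillationRates QIP ε ρ) ((Real.logb 2 (sSup S : ℕ) : ℝ) : EReal) := by
    rw [hS]
    refine ⟨Set.mem_image_of_mem _ hmem, ?_⟩
    rintro _ ⟨n, hn, rfl⟩
    refine EReal.coe_le_coe_iff.2 (Real.logb_le_logb_of_le one_lt_two ?_ ?_)
    · exact_mod_cast hpos n hn
    · exact_mod_cast le_csSup hbdd hn
  exact hgr.isLUB.sSup_eq ▸ hgr.1

end Rates

end AssistedCoherence

theorem theorem3 (a b r : ℕ) (ρ : Matrix (Fin a × Fin b) (Fin a × Fin b) ℂ)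
    (hρ : AssistedCoherence.IsState ρ) (ψ : (Fin a × Fin b) × Fin r → ℂ)
    (hψ : AssistedCoherence.IsPurification ψ ρ) (ε : ℝ) (hε : ε ∈ Set.Icc (0 : ℝ) 1) :
    AssistedCoherence.distillableCoherence AssistedCoherence.QIP ε ρ =
      AssistedCoherence.extractableRandomness AssistedCoherence.QIP ε ψ ∧
    (ε < 1 →
      AssistedCoherence.distillableCoherence AssistedCoherence.QIP ε ρ ∈
        AssistedCoherence.distillationRates AssistedCoherence.QIP ε ρ ∧
      AssistedCoherence.extractableRandomness AssistedCoherence.QIP ε ψ ∈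
        AssistedCoherence.extractionRates AssistedCoherence.QIP ε ψ) ∧
    ∀ F : AssistedCoherence.BipartiteClass,
      (∀ a b a' b' : ℕ, ∀ Λ ∈ F a b a' b', AssistedCoherence.IsChannel Λ) →
      AssistedCoherence.distillableCoherence F ε ρ ≤
        AssistedCoherence.extractableRandomness F ε ψ := by
  have heq := AssistedCoherence.distillationRates_QIP_eq_extractionRates hρ hψ hε.1
  refine ⟨congrArg sSup heq, fun hε1 => ?_, fun F hF => sSup_le_sSup
    (AssistedCoherence.distillationRates_subset_extractionRates hρ hψ hε.1 hF)⟩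
  have hmem := AssistedCoherence.sSup_distillationRates_QIP_mem hρ hε.1 hε1
  refine ⟨hmem, ?_⟩
  rw [AssistedCoherence.extractableRandomness, ← heq]
  exact hmem
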